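/- Let $d \ge 0$ be an integer. For $i \in \{1,2\}$ let $\mathcal{H}_i$ and $\mathcal{K}_i$ be non-zero separable complex Hilbert spaces and let $M_i \subseteq B(\mathcal{H}_i)$ be a unital commutative von Neumann algebra. Let $M_i \otimes B(\mathcal{K}_i)$ be the von Neumann algebra tensor product acting on the Hilbert space $\mathcal{H}_i \otimes \mathcal{K}_i$, and let $\mathcal{U}(M_i \otimes B(\mathcal{K}_i))$ be its unitary group with the strong operator topology. Give $\mathbb{R}^d \times \mathcal{U}(M_i \otimes B(\mathcal{K}_i))$ the product topology and the group structure of the cartesian product. Suppose that $\dim \mathcal{K}_1 < \dim \mathcal{K}_2$, where dimensions are elements of $\{1,2,\dots\} \cup \{\infty\}$, and let \[ \Phi : \mathbb{R}^d \times \mathcal{U}(M_2 \otimes B(\mathcal{K}_2)) \to \mathbb{R}^d \times \mathcal{U}(M_1 \otimes B(\mathcal{K}_1)) \] be a continuous group homomorphism. Then: (1) For every finite-dimensional subspace $\widetilde{\mathcal{K}}_2$ of $\mathcal{K}_2$ with $\dim \mathcal{K}_1 < \dim \widetilde{\mathcal{K}}_2$, the set $\{(0, 1 \otimes \widetilde{U})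 : U \in SU(\widetilde{\mathcal{K}}_2)\}$ is contained in the kernel of $\Phi$. Here $SU(\widetilde{\mathcal{K}}_2)$ is the group of unitary operators $U$ on $\widetilde{\mathcal{K}}_2$ with $\det U = 1$, and $\widetilde{U} = U \oplus 1$ with respect to the decomposition $\mathcal{K}_2 = \widetilde{\mathcal{K}}_2 \oplus \widetilde{\mathcal{K}}_2^{\perp}$. (2) In particular, $\Phi$ is not injective. -/

import Mathlib

open scoped TensorProduct

noncomputable section

namespace VNTensor

/-! ### Dimension -/

/-- The dimension of a separable Hilbert space, as an element of `{0, 1, 2, …} ∪ {∞}`.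
By `hilbertDim_eq_card` it is the number of elements of any orthonormal (Hilbert) basis, infinite
cardinalities being identified. -/
def hilbertDim (K : Type*) [NormedAddCommGroup K] [InnerProductSpace ℂ K] : ℕ∞ :=
  Cardinal.toENat (Module.rank ℂ K)

theorem hilbertDim_eq_card {K ι : Type*} [NormedAddCommGroup K] [InnerProductSpace ℂ K]
    [CompleteSpace K] (b : HilbertBasis ι ℂ K) : hilbertDim K = ENat.card ι := by
  classical
  rcases finite_or_infinite ι with h | h
  · have := Fintype.ofFinite ι
    have hr := rank_eq_card_basis b.toOrthonormalBasis.toBasis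
    simp [hilbertDim, hr]
  · have hli := b.orthonormal.linearIndependent
    have : ¬ FiniteDimensional ℂ K := fun hf => by
      have := hli.finite
      exact not_finite ι
    have h1 : Cardinal.aleph0 ≤ Module.rank ℂ K := by
      rw [← not_lt, Module.rank_lt_aleph0_iff]
      exact this
    rw [hilbertDim, Cardinal.toENat_eq_top.2 h1, ENat.card_eq_top_of_infinite]

/-! ### Hilbert space tensor products and tensor products of operators -/

section Tensor

variable {H K : Type*} [NormedAddCommGroup H] [InnerProductSpace ℂ H]
  [NormedAddCommGroup K] [InnerProductSpace ℂ K]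

variable (H K) in
/-- The Hilbert space tensor product: the completion of the algebraic tensor product for
`⟪a ⊗ b, c ⊗ d⟫ = ⟪a, c⟫ * ⟪b, d⟫`. -/
abbrev HilbertTensor : Type _ := UniformSpace.Completion (H ⊗[ℂ] K)

/-- The bounded operator `x ⊗ y` on the Hilbert space tensor product. -/
def tensorOp (x : H →L[ℂ] H) (y : K →L[ℂ] K) : HilbertTensor H K →L[ℂ] HilbertTensor H K :=
  (TensorProduct.mapL x y).completion

theorem tensorOp_coe (x : H →L[ℂ] H) (y : K →L[ℂ] K) (v : H ⊗[ℂ] K) :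
    tensorOp x y (v : HilbertTensor H K) =
      ((TensorProduct.mapL x y v : H ⊗[ℂ] K) : HilbertTensor H K) :=
  ContinuousLinearMap.completion_apply_coe _ _

theorem tensorOp_coe_tmul (x : H →L[ℂ] H) (y : K →L[ℂ] K) (h : H) (k : K) :
    tensorOp x y ((h ⊗ₜ[ℂ] k : H ⊗[ℂ] K) : HilbertTensor H K) =
      ((x h ⊗ₜ[ℂ] y k : H ⊗[ℂ] K) : HilbertTensor H K) := by
  rw [tensorOp_coe, TensorProduct.mapL_tmul]

theorem ext_coe {S T : HilbertTensor H K →L[ℂ] HilbertTensor H K}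
    (h : ∀ v : H ⊗[ℂ] K, S (v : HilbertTensor H K) = T (v : HilbertTensor H K)) : S = T := by
  ext v
  exact congrFun (UniformSpace.Completion.denseRange_coe.equalizer S.continuous T.continuous
    (funext h)) v

theorem tensorOp_one : tensorOp (1 : H →L[ℂ] H) (1 : K →L[ℂ] K) = 1 := by
  refine ext_coe fun v => ?_
  rw [tensorOp_coe]
  congr 1
  exact congrArg (fun f : H ⊗[ℂ] K →L[ℂ] H ⊗[ℂ] K => f v) TensorProduct.mapL_id_id

theorem tensorOp_mul (x x' : H →L[ℂ] H) (y y' : K →L[ℂ] K) :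
    tensorOp (x * x') (y * y') = tensorOp x y * tensorOp x' y' := by
  refine ext_coe fun v => ?_
  rw [mul_apply_eq_comp, tensorOp_coe, tensorOp_coe, tensorOp_coe,
    TensorProduct.mapL_mul, mul_apply_eq_comp]

theorem inner_mapL [CompleteSpace H] [CompleteSpace K] (x : H →L[ℂ] H) (y : K →L[ℂ] K)
    (v w : H ⊗[ℂ] K) :
    inner ℂ (TensorProduct.mapL (star x) (star y) v) w = inner ℂ v (TensorProduct.mapL x y w) := by
  induction v with
  | zero => simp
  | add a b ha hb => simp only [map_add, inner_add_left, ha, hb]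
  | tmul a b =>
    induction w with
    | zero => simp
    | add c d hc hd => simp only [map_add, inner_add_right, hc, hd]
    | tmul c d =>
      rw [TensorProduct.mapL_tmul, TensorProduct.mapL_tmul, TensorProduct.inner_tmul,
        TensorProduct.inner_tmul, ContinuousLinearMap.star_eq_adjoint,
        ContinuousLinearMap.star_eq_adjoint, ContinuousLinearMap.adjoint_inner_left,
        ContinuousLinearMap.adjoint_inner_left]

theorem star_tensorOp [CompleteSpace H] [CompleteSpace K] (x : H →L[ℂ] H) (y : K →L[ℂ] K) :
    star (tensorOp x y) = tensorOp (star x) (star y) := by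
  symm
  rw [ContinuousLinearMap.star_eq_adjoint (tensorOp x y), ContinuousLinearMap.eq_adjoint_iff]
  intro v w
  refine UniformSpace.Completion.induction_on₂ v w ?_ ?_
  · exact isClosed_eq
      (((tensorOp (star x) (star y)).continuous.comp continuous_fst).inner continuous_snd)
      (continuous_fst.inner ((tensorOp x y).continuous.comp continuous_snd))
  · intro a b
    rw [tensorOp_coe, tensorOp_coe, UniformSpace.Completion.inner_coe,
      UniformSpace.Completion.inner_coe, inner_mapL]

end Tensor

/-! ### Von Neumann algebras and their unitary groups -/

section VonNeumann

variable {H K : Type*} [NormedAddCommGroup H] [InnerProductSpace ℂ H] [CompleteSpace H]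
  [NormedAddCommGroup K] [InnerProductSpace ℂ K] [CompleteSpace K]

/-- The von Neumann algebra `(S ∪ S*)''` generated by a set `S` of operators. -/
def generated (S : Set (H →L[ℂ] H)) : VonNeumannAlgebra H where
  toStarSubalgebra := StarSubalgebra.centralizer ℂ (StarSubalgebra.centralizer ℂ S : Set (H →L[ℂ] H))
  centralizer_centralizer' := by
    change Set.centralizer (Set.centralizer (StarSubalgebra.centralizer ℂ
      (StarSubalgebra.centralizer ℂ S : Set (H →L[ℂ] H)) : Set (H →L[ℂ] H))) =
        (StarSubalgebra.centralizer ℂ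
          (StarSubalgebra.centralizer ℂ S : Set (H →L[ℂ] H)) : Set (H →L[ℂ] H))
    rw [StarSubalgebra.coe_centralizer_centralizer, Set.centralizer_centralizer_centralizer]

theorem coe_generated (S : Set (H →L[ℂ] H)) :
    (generated S : Set (H →L[ℂ] H)) = (S ∪ star S).centralizer.centralizer :=
  StarSubalgebra.coe_centralizer_centralizer ℂ S

theorem subset_generated (S : Set (H →L[ℂ] H)) : S ⊆ (generated S : Set (H →L[ℂ] H)) := by
  rw [coe_generated]
  exact fun x hx => Set.subset_centralizer_centralizer (Or.inl hx)

/-- The von Neumann algebra tensor product `M ⊗ B(K)` acting on `H ⊗ K`: the von Neumann algebra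
generated by all `x ⊗ y` with `x ∈ M` and `y ∈ B(K)`. -/
def tensorB (M : VonNeumannAlgebra H) (K : Type*) [NormedAddCommGroup K] [InnerProductSpace ℂ K]
    [CompleteSpace K] : VonNeumannAlgebra (HilbertTensor H K) :=
  generated {T | ∃ x ∈ M, ∃ y : K →L[ℂ] K, T = tensorOp x y}

theorem tensorOp_mem_tensorB {M : VonNeumannAlgebra H} {x : H →L[ℂ] H} (hx : x ∈ M)
    (y : K →L[ℂ] K) : tensorOp x y ∈ tensorB M K :=
  subset_generated _ ⟨x, hx, y, rfl⟩

/-- The unitaries of `M`, as a subgroup of the unitary group of `B(H)`. -/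
def unitarySubgroup (M : VonNeumannAlgebra H) : Subgroup (unitary (H →L[ℂ] H)) where
  carrier := {U | (U : H →L[ℂ] H) ∈ M}
  mul_mem' {U V} hU hV := by
    change (U : H →L[ℂ] H) * (V : H →L[ℂ] H) ∈ M
    exact mul_mem hU hV
  one_mem' := by
    change (1 : H →L[ℂ] H) ∈ M
    exact one_mem M
  inv_mem' {U} hU := by
    change star (U : H →L[ℂ] H) ∈ M
    exact star_mem hU

/-- The unitary group `𝒰(M)`, to be given the strong operator topology. -/
def VNUnitary (M : VonNeumannAlgebra H) : Type _ := unitarySubgroup M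

namespace VNUnitary

variable {M : VonNeumannAlgebra H}

instance : Group (VNUnitary M) := inferInstanceAs (Group (unitarySubgroup M))

/-- The underlying bounded operator of an element of `𝒰(M)`. -/
def toOp (U : VNUnitary M) : H →L[ℂ] H :=
  ((show unitarySubgroup M from U : unitary (H →L[ℂ] H)) : H →L[ℂ] H)

/-- The element of `𝒰(M)` given by a unitary operator belonging to `M`. -/
def mk (T : H →L[ℂ] H) (hT : T ∈ unitary (H →L[ℂ] H)) (hM : T ∈ M) : VNUnitary M :=
  (⟨⟨T, hT⟩, hM⟩ : unitarySubgroup M)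

@[simp] theorem toOp_mk (T : H →L[ℂ] H) (hT : T ∈ unitary (H →L[ℂ] H)) (hM : T ∈ M) :
    (mk T hT hM).toOp = T := rfl

@[simp] theorem toOp_one : (1 : VNUnitary M).toOp = 1 := rfl

@[simp] theorem toOp_mul (U V : VNUnitary M) : (U * V).toOp = U.toOp * V.toOp := rfl

theorem toOp_injective : Function.Injective (toOp : VNUnitary M → (H →L[ℂ] H)) :=
  fun _ _ h => Subtype.ext (Subtype.ext h)

/-- The strong operator topology on `𝒰(M)`: the topology of pointwise convergence on `H`. -/
instance : TopologicalSpace (VNUnitary M) :=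
  TopologicalSpace.induced (fun U => (fun v => U.toOp v : H → H)) inferInstance

/-- The topology on `𝒰(M)` is the one induced by Mathlib's strong operator topology. -/
theorem isInducing_toPointwiseConvergenceCLM : Topology.IsInducing (fun U : VNUnitary M =>
    ContinuousLinearMap.toPointwiseConvergenceCLM ℂ (RingHom.id ℂ) H H U.toOp) := by
  rw [← (PointwiseConvergenceCLM.isEmbedding_coeFn (RingHom.id ℂ) H H).isInducing.of_comp_iff]
  exact ⟨rfl⟩

end VNUnitary

end VonNeumann

/-! ### The embedding `U ↦ 1 ⊗ (U ⊕ 1)` -/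

section Embedding

variable {K : Type*} [NormedAddCommGroup K] [InnerProductSpace ℂ K] [CompleteSpace K]

/-- The special unitary group of a finite-dimensional Hilbert space: the unitary operators of
determinant one. -/
def specialUnitary (L : Type*) [NormedAddCommGroup L] [InnerProductSpace ℂ L] :
    Subgroup (L ≃ₗᵢ[ℂ] L) where
  carrier := {U | LinearMap.det (U.toLinearEquiv : L →ₗ[ℂ] L) = 1}
  mul_mem' {U V} hU hV := by
    change LinearMap.det ((U.toLinearEquiv : L →ₗ[ℂ] L) * (V.toLinearEquiv : L →ₗ[ℂ] L)) = 1
    rw [map_mul, hU, hV, one_mul]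
  one_mem' := by
    change LinearMap.det (1 : L →ₗ[ℂ] L) = 1
    exact map_one _
  inv_mem' {U} hU := by
    have h : (U.toLinearEquiv : L →ₗ[ℂ] L) * (U⁻¹.toLinearEquiv : L →ₗ[ℂ] L) = 1 := by
      ext v
      exact U.apply_symm_apply v
    have h2 := congrArg LinearMap.det h
    rw [map_mul, hU, one_mul, map_one] at h2
    exact h2

/-- The operator `U ⊕ 1` on `K = L ⊕ Lᗮ`. -/
def directSumOne (L : Submodule ℂ K) [FiniteDimensional ℂ L] (U : L ≃ₗᵢ[ℂ] L) : K →L[ℂ] K :=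
  L.subtypeL ∘L (U.toContinuousLinearEquiv : L →L[ℂ] L) ∘L L.orthogonalProjectionOnto +
    Lᗮ.starProjection

variable (L : Submodule ℂ K) [FiniteDimensional ℂ L]

theorem directSumOne_add (U : L ≃ₗᵢ[ℂ] L) (v : L) {w : K} (hw : w ∈ Lᗮ) :
    directSumOne L U (v + w) = U v + w := by
  have h1 : L.orthogonalProjectionOnto (v + w) = v := by
    rw [map_add, Submodule.orthogonalProjectionOnto_mem_subspace_eq_self,
      Submodule.orthogonalProjectionOnto_apply_of_mem_orthogonal hw, add_zero]
  have h2 : Lᗮ.starProjection (v + w : K) = w := by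
    rw [map_add, Submodule.starProjection_eq_self_iff.2 hw, Submodule.starProjection_orthogonal_val,
      Submodule.starProjection_eq_self_iff.2 v.2, sub_self, zero_add]
  change ((U (L.orthogonalProjectionOnto (v + w)) : L) : K) + Lᗮ.starProjection (v + w : K) = _
  rw [h1, h2]

theorem exists_add {K : Type*} [NormedAddCommGroup K] [InnerProductSpace ℂ K]
    (L : Submodule ℂ K) [FiniteDimensional ℂ L] (x : K) : ∃ (v : L) (w : K), w ∈ Lᗮ ∧ x = v + w := by
  obtain ⟨y, hy, z, hz, h⟩ := L.exists_add_mem_mem_orthogonal x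
  exact ⟨⟨y, hy⟩, z, hz, h⟩

theorem directSumOne_mul (U V : L ≃ₗᵢ[ℂ] L) :
    directSumOne L U * directSumOne L V = directSumOne L (U * V) := by
  ext x
  obtain ⟨v, w, hw, rfl⟩ := exists_add L x
  rw [mul_apply_eq_comp, directSumOne_add L V v hw, directSumOne_add L U (V v) hw,
    directSumOne_add L (U * V) v hw]
  rfl

theorem directSumOne_one : directSumOne L 1 = 1 := by
  ext x
  obtain ⟨v, w, hw, rfl⟩ := exists_add L x
  rw [directSumOne_add L 1 v hw]
  rfl

theorem star_directSumOne (U : L ≃ₗᵢ[ℂ] L) : star (directSumOne L U) = directSumOne L U⁻¹ := by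
  symm
  rw [ContinuousLinearMap.star_eq_adjoint, ContinuousLinearMap.eq_adjoint_iff]
  intro x y
  obtain ⟨v, w, hw, rfl⟩ := exists_add L x
  obtain ⟨v', w', hw', rfl⟩ := exists_add L y
  rw [directSumOne_add L _ v hw, directSumOne_add L _ v' hw']
  have h : inner ℂ (U⁻¹ v) v' = inner ℂ v (U v') := by
    rw [← U.inner_map_map (U⁻¹ v) v']
    congr 1
    exact U.apply_symm_apply v
  have h' : inner ℂ ((U⁻¹ v : L) : K) (v' : K) = inner ℂ (v : K) ((U v' : L) : K) := h
  simp only [inner_add_left, inner_add_right, h',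
    Submodule.inner_right_of_mem_orthogonal (Subtype.prop _) hw',
    Submodule.inner_left_of_mem_orthogonal (Subtype.prop _) hw]

theorem directSumOne_mem_unitary (U : L ≃ₗᵢ[ℂ] L) :
    directSumOne L U ∈ unitary (K →L[ℂ] K) := by
  rw [Unitary.mem_iff, star_directSumOne, directSumOne_mul, directSumOne_mul, inv_mul_cancel,
    mul_inv_cancel, directSumOne_one]
  exact ⟨rfl, rfl⟩

variable {H : Type*} [NormedAddCommGroup H] [InnerProductSpace ℂ H] [CompleteSpace H]

theorem tensorOp_one_mem_unitary {y : K →L[ℂ] K} (hy : y ∈ unitary (K →L[ℂ] K)) :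
    tensorOp (1 : H →L[ℂ] H) y ∈ unitary (HilbertTensor H K →L[ℂ] HilbertTensor H K) := by
  rw [Unitary.mem_iff] at hy ⊢
  constructor
  · rw [star_tensorOp, ← tensorOp_mul, star_one, one_mul, hy.1, tensorOp_one]
  · rw [star_tensorOp, ← tensorOp_mul, star_one, one_mul, hy.2, tensorOp_one]

/-- The element `1 ⊗ (U ⊕ 1)` of `𝒰(M ⊗ B(K))`, for a unitary operator `U` on the
finite-dimensional subspace `L` of `K`. -/
def embed (M : VonNeumannAlgebra H) (L : Submodule ℂ K) [FiniteDimensional ℂ L]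
    (U : L ≃ₗᵢ[ℂ] L) : VNUnitary (tensorB M K) :=
  VNUnitary.mk (tensorOp 1 (directSumOne L U))
    (tensorOp_one_mem_unitary (directSumOne_mem_unitary L U))
    (tensorOp_mem_tensorB (one_mem M) _)

end Embedding

/-- The topological group `ℝ^d × 𝒰(M)`, with the product topology and the product group structure,
the additive group `ℝ^d` being written multiplicatively. -/
abbrev ProdGroup (d : ℕ) {H : Type*} [NormedAddCommGroup H] [InnerProductSpace ℂ H]
    [CompleteSpace H] (M : VonNeumannAlgebra H) : Type _ :=
  Multiplicative (EuclideanSpace ℝ (Fin d)) × VNUnitary M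

end VNTensor

end

/-! ### Weights of commuting torsion elements permuted by a group -/

section Weights

open Module Module.End

/-! Since `hilbertDim K₁` is strictly smaller than another dimension, `K₁` is finite-dimensional,
and matrix entries embed `𝒰(M₁ ⊗ B(K₁))` into the matrices of size `dim K₁` over the commutative
reduced ring `M₁`. Residue fields at primes detect equality over a reduced ring, so the question
becomes one about representations of the unitary group of `L` on `F ^ dim K₁`, with `F`
algebraically closed and `dim K₁ < n = dim L`.

In such a representation take the diagonal unitaries `spike w j`, with `w ^ (n - 1)` at place `j`
and `w⁻¹` elsewhere, where `w ^ p = 1` and `p` is coprime to `n`. They commute and are permuted by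
permutation unitaries. A joint eigenvector with non-constant weight `c : ι → F` would have at least
`n` distinct permuted weights, hence give `n` independent vectors in a space of dimension less than
`n` (`weight_const_of_finrank_lt`). So each weight is a constant, which satisfies `c ^ p = 1` by
torsion and `c ^ n = 1` because the product of the spikes over `j` is `1`; thus `c = 1`. The factor
`ℝ^d` is torsion-free and kills the same elements.

Such `w` are dense in the circle, so continuity of `Φ` removes the torsion condition. Every special
unitary is diagonalizable (`exists_eq_diagUnitary`), and a diagonal one of determinant one is a
product of spikes (`exists_eq_prod_spike`). Non-injectivity follows from a subspace of dimension
`dim K₁ + 1`. -/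

theorem exists_injective_comp_swap {ι F : Type*} [Fintype ι] [DecidableEq ι] {c : ι → F}
    {a b : ι} (hab : c a ≠ c b) :
    ∃ τ : ι → ι × ι, Function.Injective fun i => c ∘ Equiv.swap (τ i).1 (τ i).2 := by
  classical
  -- The place `a` gets the identity. If `c i = c a`, the swap with `b` puts the value `c b` at `i`;
  -- otherwise the swap with `a` puts `c a` at `i` and changes the value at `a`. Comparing values at
  -- `a`, `b`, `i` and `j` separates all cases.
  refine ⟨fun i => if i = a then (a, a) else if c i = c a then (i, b) else (a, i), ?_⟩
  have key : ∀ i x, (c ∘ Equiv.swap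
      (if i = a then (a, a) else if c i = c a then (i, b) else (a, i)).1
      (if i = a then (a, a) else if c i = c a then (i, b) else (a, i)).2) x =
      if i = a then c x else if c i = c a then (if x = i then c b else if x = b then c a else c x)
      else (if x = a then c i else if x = i then c a else c x) := by
    intro i x
    simp only [Function.comp]
    split_ifs <;> simp_all [Equiv.swap_apply_def]
  intro i j hij
  have h1 : ∀ x, _ = _ := fun x => (key i x).symm.trans ((congrFun hij x).trans (key j x))
  have ha := h1 a
  have hb := h1 b
  have hi := h1 i
  have hj := h1 j
  clear key h1 hij
  grind

variable {F V G : Type*} [Field F] [AddCommGroup V] [Module F V] [Group G]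

/-- `X ^ p - 1` is separable when `p` is invertible in the field, so an operator it annihilates is
semisimple. -/
theorem maxGenEigenspace_eq_eigenspace_of_pow_eq_one {f : End F V} {p : ℕ} (hp : (p : F) ≠ 0)
    (hf : f ^ p = 1) (μ : F) : f.maxGenEigenspace μ = f.eigenspace μ := by
  refine IsFinitelySemisimple.maxGenEigenspace_eq_eigenspace
    (IsSemisimple.isFinitelySemisimple ?_) μ
  refine isSemisimple_of_squarefree_aeval_eq_zero (p := Polynomial.X ^ p - 1)
    (Polynomial.X_pow_sub_one_separable_iff.2 hp).squarefree ?_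
  simp [hf]

variable {T ι : Type*} [CommGroup T] [Fintype ι] [DecidableEq ι] (D : T →* G) {t : ι → T}

/-- An element `g` realizing a transposition carries a vector of weight `c` to one of weight `c ∘
swap`. Joint generalized eigenspaces for distinct weights are independent, so a non-constant `c`
produces too many independent vectors. -/
theorem weight_const_of_finrank_lt [FiniteDimensional F V] (ρ : G →* End F V)
    (hperm : ∀ i j, ∃ g : G, ∀ k, g * D (t k) = D (t (Equiv.swap i j k)) * g)
    (hcard : finrank F V < Fintype.card ι) {c : ι → F} {v : V} (hv : v ≠ 0)
    (hc : ∀ i, ρ (D (t i)) v = c i • v) (a b : ι) : c a = c b := by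
  by_contra hab
  obtain ⟨τ, hτ⟩ := exists_injective_comp_swap hab
  choose g hg using fun i => hperm (τ i).1 (τ i).2
  have hind := independent_iInf_maxGenEigenspace_of_forall_mapsTo (fun i => ρ (D (t i)))
    (fun i j φ => mapsTo_maxGenEigenspace_of_comm
      (((Commute.all (t j) (t i)).map D).map ρ) φ)
  have hmem : ∀ i, ρ (g i) v ∈ ⨅ k, maxGenEigenspace (ρ (D (t k)))
      ((c ∘ Equiv.swap (τ i).1 (τ i).2) k) := by
    intro i
    rw [Submodule.mem_iInf]
    intro k
    refine (genEigenspace (ρ (D (t k))) _).monotone (le_top (a := 1)) ?_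
    change _ ∈ eigenspace _ _
    rw [mem_eigenspace_iff]
    have h := congrArg (fun f => ρ f v) (hg i (Equiv.swap (τ i).1 (τ i).2 k))
    simp only [map_mul, Module.End.mul_apply, Equiv.swap_apply_self, hc, map_smul] at h
    simp [← h]
  have hli := (hind.comp hτ).linearIndependent _ hmem (fun i h => hv (by
    have := congrArg (ρ (g i)⁻¹) h
    rwa [← Module.End.mul_apply, ← map_mul, inv_mul_cancel, map_one, map_zero] at this))
  exact absurd hli.fintype_card_le_finrank (not_le.2 hcard)

theorem map_eq_one_of_finrank_lt [FiniteDimensional F V] [IsAlgClosed F] (ρ : G →* End F V)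
    {p : ℕ} (hp : (p : F) ≠ 0)
    (hcop : p.Coprime (Fintype.card ι)) (hpow : ∀ i, t i ^ p = 1) (hprod : ∏ i, t i = 1)
    (hperm : ∀ i j, ∃ g : G, ∀ k, g * D (t k) = D (t (Equiv.swap i j k)) * g)
    (hcard : finrank F V < Fintype.card ι) (i : ι) : ρ (D (t i)) = 1 := by
  have htop := iSup_iInf_maxGenEigenspace_eq_top_of_iSup_maxGenEigenspace_eq_top_of_commute
    (fun i => ρ (D (t i))) (fun i j _ => ((Commute.all (t i) (t j)).map D).map ρ)
    (fun i => iSup_maxGenEigenspace_eq_top (ρ (D (t i))))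
  have hle : ⨆ χ : ι → F, ⨅ k, maxGenEigenspace (ρ (D (t k))) (χ k) ≤
      LinearMap.ker (ρ (D (t i)) - 1) := by
    refine iSup_le fun c v hv => ?_
    rw [Submodule.mem_iInf] at hv
    have hc : ∀ k, ρ (D (t k)) v = c k • v := fun k => by
      have := hv k
      rw [maxGenEigenspace_eq_eigenspace_of_pow_eq_one hp
        (by rw [← map_pow, ← map_pow, hpow, map_one, map_one])] at this
      exact mem_eigenspace_iff.1 this
    rcases eq_or_ne v 0 with rfl | hv0
    · exact zero_mem _
    have hconst := weight_const_of_finrank_lt D ρ hperm hcard hv0 hc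
    have h1 : c i ^ p = 1 := by
      have h : ∀ q : ℕ, (ρ (D (t i)) ^ q) v = c i ^ q • v := by
        intro q
        induction q with
        | zero => simp
        | succ q ih => rw [pow_succ', Module.End.mul_apply, ih, map_smul, hc, smul_smul, pow_succ]
      have h2 := h p
      rw [← map_pow, ← map_pow, hpow, map_one, map_one, Module.End.one_apply] at h2
      exact (smul_left_injective F hv0 (by simpa using h2)).symm
    -- All the `c k` equal `c i`, so the product of the `t k`, which is `1`, acts on `v` by this
    -- power.
    have h2 : c i ^ Fintype.card ι = 1 := by
      have h : ∀ s : Finset ι, ρ (D (∏ k ∈ s, t k)) v = c i ^ s.card • v := by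
        intro s
        induction s using Finset.induction_on with
        | empty => simp
        | insert a s ha ih =>
          rw [Finset.prod_insert ha, map_mul, map_mul, Module.End.mul_apply, ih,
            map_smul, hc, hconst a i, smul_smul, Finset.card_insert_of_notMem ha, pow_succ]
      have h2 := h Finset.univ
      rw [hprod, map_one, map_one, Module.End.one_apply] at h2
      exact (smul_left_injective F hv0 (by simpa using h2)).symm
    have h3 : c i = 1 := by
      rw [← orderOf_eq_one_iff, ← Nat.dvd_one, ← hcop.gcd_eq_one]
      exact Nat.dvd_gcd (orderOf_dvd_of_pow_eq_one h1) (orderOf_dvd_of_pow_eq_one h2)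
    simp [hc, h3]
  rw [htop, top_le_iff, LinearMap.ker_eq_top, sub_eq_zero] at hle
  exact hle

/-- In a reduced ring only `0` lies in every prime. Each prime quotient embeds in an algebraically
closed field, where the result over fields applies; invertibility of `p` in `R` keeps it nonzero
there. -/
theorem matrix_map_eq_one_of_card_lt {R κ : Type*} [CommRing R] [IsReduced R] [Fintype κ]
    [DecidableEq κ] (ρ : G →* Matrix κ κ R) {p : ℕ} (hp : IsUnit (p : R))
    (hcop : p.Coprime (Fintype.card ι)) (hpow : ∀ i, t i ^ p = 1) (hprod : ∏ i, t i = 1)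
    (hperm : ∀ i j, ∃ g : G, ∀ k, g * D (t k) = D (t (Equiv.swap i j k)) * g)
    (hcard : Fintype.card κ < Fintype.card ι) (i : ι) : ρ (D (t i)) = 1 := by
  rw [← sub_eq_zero]
  ext a b
  refine (nilpotent_iff_mem_prime.2 fun J hJ => ?_ : IsNilpotent _).eq_zero
  let F := AlgebraicClosure (FractionRing (R ⧸ J))
  let φ : R →+* F := ((algebraMap (FractionRing (R ⧸ J)) F).comp
    (algebraMap (R ⧸ J) (FractionRing (R ⧸ J)))).comp (Ideal.Quotient.mk J)
  have hφ : ∀ x, φ x = 0 → x ∈ J := fun x hx => by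
    rw [← Ideal.Quotient.eq_zero_iff_mem]
    refine IsFractionRing.injective (R ⧸ J) (FractionRing (R ⧸ J)) ?_
    rw [map_zero]
    exact (algebraMap (FractionRing (R ⧸ J)) F).injective (by rw [map_zero]; exact hx)
  refine hφ _ ?_
  let ψ : Matrix κ κ R →* End F (κ → F) :=
    (Matrix.toLinAlgEquiv' : Matrix κ κ F ≃ₐ[F] _).toRingEquiv.toRingHom.toMonoidHom.comp
      (φ.mapMatrix.toMonoidHom)
  have h := map_eq_one_of_finrank_lt D (ψ.comp ρ) (p := p)
    (by simpa using (hp.map φ).ne_zero) hcop hpow hprod hperm (by simpa using hcard) i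
  have h2 : φ.mapMatrix (ρ (D (t i))) = 1 :=
    (Matrix.toLinAlgEquiv' : Matrix κ κ F ≃ₐ[F] _).injective (by rw [map_one]; exact h)
  have h3 : φ.mapMatrix (ρ (D (t i)) - 1) = 0 := by rw [map_sub, h2, map_one, sub_self]
  exact congrFun (congrFun h3 a) b

end Weights

noncomputable section

namespace VNTensor

/-! ### Matrix entries of operators on the Hilbert tensor product -/

section Entries

variable {H K : Type*} [NormedAddCommGroup H] [InnerProductSpace ℂ H]
  [NormedAddCommGroup K] [InnerProductSpace ℂ K]

/-- The operator `h ↦ h ⊗ k`. -/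
def tmulRight (H : Type*) [NormedAddCommGroup H] [InnerProductSpace ℂ H] (k : K) :
    H →L[ℂ] HilbertTensor H K :=
  UniformSpace.Completion.toComplL ∘L (TensorProduct.mkL ℂ H K).flip k

theorem tmulRight_apply (k : K) (h : H) :
    tmulRight H k h = ((h ⊗ₜ[ℂ] k : H ⊗[ℂ] K) : HilbertTensor H K) := rfl

theorem tensorOp_one_comp_tmulRight (a : H →L[ℂ] H) (k : K) :
    tensorOp a (1 : K →L[ℂ] K) ∘L tmulRight H k = tmulRight H k ∘L a := by
  ext h
  exact tensorOp_coe_tmul a 1 h k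

variable [CompleteSpace H]

theorem adjoint_tmulRight_coe_tmul (k : K) (h : H) (k' : K) :
    (tmulRight H k).adjoint ((h ⊗ₜ[ℂ] k' : H ⊗[ℂ] K) : HilbertTensor H K) = inner ℂ k k' • h := by
  refine ext_inner_left ℂ fun v => ?_
  rw [ContinuousLinearMap.adjoint_inner_right, tmulRight_apply, UniformSpace.Completion.inner_coe,
    TensorProduct.inner_tmul, inner_smul_right, mul_comm]

theorem adjoint_tmulRight_comp_tensorOp_one (a : H →L[ℂ] H) (k : K) :
    (tmulRight H k).adjoint ∘L tensorOp a (1 : K →L[ℂ] K) = a ∘L (tmulRight H k).adjoint := by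
  ext v
  refine congrFun (UniformSpace.Completion.denseRange_coe.equalizer
    (ContinuousLinearMap.continuous _) (ContinuousLinearMap.continuous _) (funext fun v => ?_)) v
  induction v with
  | zero => simp only [Function.comp_apply, UniformSpace.Completion.coe_zero, map_zero]
  | add a b ha hb =>
    simp only [Function.comp_apply, UniformSpace.Completion.coe_add, map_add] at ha hb ⊢
    rw [ha, hb]
  | tmul h k' =>
    simp only [Function.comp_apply, ContinuousLinearMap.comp_apply, tensorOp_coe_tmul,
      adjoint_tmulRight_coe_tmul, one_apply_eq_self, map_smul]

variable {κ : Type*} [Fintype κ] (b : OrthonormalBasis κ ℂ K)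

theorem sum_tmulRight_comp_adjoint :
    ∑ i, tmulRight H (b i) ∘L (tmulRight H (b i)).adjoint = 1 := by
  refine ext_coe fun v => ?_
  induction v with
  | zero => rw [UniformSpace.Completion.coe_zero, map_zero, map_zero]
  | add a b ha hb => rw [UniformSpace.Completion.coe_add, map_add, map_add, ha, hb]
  | tmul h k =>
    rw [sum_apply, one_apply_eq_self]
    simp only [ContinuousLinearMap.comp_apply, adjoint_tmulRight_coe_tmul, map_smul,
      tmulRight_apply]
    simp only [← UniformSpace.Completion.coe_smul, ← TensorProduct.tmul_smul]
    conv_rhs => rw [← b.sum_repr' k, TensorProduct.tmul_sum]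
    exact (map_sum (UniformSpace.Completion.toComplL : H ⊗[ℂ] K →L[ℂ] _) _ _).symm

/-- The matrix entries of an operator on `H ⊗ K` with respect to an orthonormal basis of `K`. -/
def entry (i j : κ) (T : HilbertTensor H K →L[ℂ] HilbertTensor H K) : H →L[ℂ] H :=
  (tmulRight H (b i)).adjoint ∘L T ∘L tmulRight H (b j)

theorem entry_mul (i j : κ) (S T : HilbertTensor H K →L[ℂ] HilbertTensor H K) :
    entry b i j (S * T) = ∑ k, entry b i k S * entry b k j T := by
  have h : S * T = ∑ k, S ∘L (tmulRight H (b k) ∘L (tmulRight H (b k)).adjoint) ∘L T := by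
    conv_lhs => rw [← one_mul T, ← sum_tmulRight_comp_adjoint b, Finset.sum_mul, Finset.mul_sum]
    rfl
  ext v
  rw [h]
  simp [entry]

theorem entry_one [DecidableEq κ] (i j : κ) :
    entry b i j (1 : HilbertTensor H K →L[ℂ] HilbertTensor H K) = if i = j then 1 else 0 := by
  ext v
  change (tmulRight H (b i)).adjoint (tmulRight H (b j) v) = _
  rw [tmulRight_apply, adjoint_tmulRight_coe_tmul, orthonormal_iff_ite.1 b.orthonormal]
  split_ifs <;> simp

theorem eq_of_entry_eq {S T : HilbertTensor H K →L[ℂ] HilbertTensor H K}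
    (h : ∀ i j, entry b i j S = entry b i j T) : S = T := by
  have key : ∀ X : HilbertTensor H K →L[ℂ] HilbertTensor H K,
      X = ∑ i, ∑ j, tmulRight H (b i) ∘L entry b i j X ∘L (tmulRight H (b j)).adjoint := by
    intro X
    conv_lhs => rw [← one_mul X, ← mul_one (1 * X), ← sum_tmulRight_comp_adjoint b,
      Finset.sum_mul, Finset.sum_mul]
    simp_rw [Finset.mul_sum]
    rfl
  rw [key S, key T]
  simp_rw [h]

variable [CompleteSpace K]

/-- For `a` in the commutant of `M`, the operator `a ⊗ 1` commutes with the generators `x ⊗ y` and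
their adjoints, hence with `T`. So every entry of `T` commutes with `a`, and the bicommutant
property places it in `M`. -/
theorem entry_mem {M : VonNeumannAlgebra H} {T : HilbertTensor H K →L[ℂ] HilbertTensor H K}
    (hT : T ∈ tensorB M K) (i j : κ) : entry b i j T ∈ M := by
  rw [← SetLike.mem_coe, ← M.centralizer_centralizer]
  intro a ha
  have hT' : T ∈ (generated {T | ∃ x ∈ M, ∃ y : K →L[ℂ] K, T = tensorOp x y} :
    Set (HilbertTensor H K →L[ℂ] HilbertTensor H K)) := hT
  rw [coe_generated] at hT'
  have hcomm : tensorOp a (1 : K →L[ℂ] K) * T = T * tensorOp a (1 : K →L[ℂ] K) := by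
    refine hT' _ ?_
    have hx : ∀ x ∈ M, ∀ y : K →L[ℂ] K,
        tensorOp x y * tensorOp a 1 = tensorOp a 1 * tensorOp x y := fun x hx y => by
      rw [← tensorOp_mul, ← tensorOp_mul, ha x hx, one_mul, mul_one]
    rintro S (⟨x, hxM, y, rfl⟩ | ⟨x, hxM, y, hS⟩)
    · exact hx x hxM y
    · rw [← star_star S, hS, star_tensorOp]
      exact hx _ (star_mem hxM) _
  calc a ∘L (tmulRight H (b i)).adjoint ∘L T ∘L tmulRight H (b j)
      = (tmulRight H (b i)).adjoint ∘L (tensorOp a (1 : K →L[ℂ] K) * T) ∘L tmulRight H (b j) := by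
        rw [← ContinuousLinearMap.comp_assoc, ← adjoint_tmulRight_comp_tensorOp_one]
        rfl
    _ = (tmulRight H (b i)).adjoint ∘L T ∘L (tensorOp a (1 : K →L[ℂ] K) ∘L tmulRight H (b j)) := by
        rw [hcomm]
        rfl
    _ = entry b i j T * a := by
        rw [tensorOp_one_comp_tmulRight]
        rfl

end Entries

/-! ### Unitaries as matrices over a commutative von Neumann algebra -/

section CommVN

variable {H : Type*} [NormedAddCommGroup H] [InnerProductSpace ℂ H] [CompleteSpace H]

theorem VNUnitary.toOp_mem {M : VonNeumannAlgebra H} (U : VNUnitary M) : U.toOp ∈ M :=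
  (show unitarySubgroup M from U).2

/-- If `x² = 0`, commutativity gives `(x*x)*(x*x) = 0`, and the C*-identity applied twice gives `x =
0`. -/
theorem isReduced_of_commute (M : VonNeumannAlgebra H) (hM : ∀ a ∈ M, ∀ b ∈ M, a * b = b * a) :
    IsReduced M := by
  refine (isReduced_iff_pow_one_lt 2 one_lt_two).2 ?_
  rintro ⟨x, hx⟩ h
  have h : x * x = 0 := by simpa [pow_two] using congrArg Subtype.val h
  have h1 : star (star x * x) * (star x * x) = 0 := by
    rw [star_mul, star_star, hM _ (star_mem hx) x hx, ← mul_assoc, mul_assoc x,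
      hM _ (star_mem hx) x hx, ← mul_assoc, h, zero_mul, zero_mul]
  exact Subtype.ext (CStarRing.star_mul_self_eq_zero_iff _ |>.1
    (CStarRing.star_mul_self_eq_zero_iff _ |>.1 h1))

variable {K κ : Type*} [NormedAddCommGroup K] [InnerProductSpace ℂ K] [CompleteSpace K]
  [Fintype κ] [DecidableEq κ]

/-- The matrix of a unitary of `M ⊗ B(K)`, with respect to an orthonormal basis of `K`. -/
def entryHom (b : OrthonormalBasis κ ℂ K) (M : VonNeumannAlgebra H) :
    VNUnitary (tensorB M K) →* Matrix κ κ M where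
  toFun U := Matrix.of fun i j => ⟨entry b i j U.toOp, entry_mem b U.toOp_mem i j⟩
  map_one' := by
    ext i j : 3
    simp only [VNUnitary.toOp_one, entry_one, Matrix.of_apply, Matrix.one_apply]
    split_ifs <;> rfl
  map_mul' U V := by
    ext i j : 3
    simp [entry_mul, Matrix.mul_apply]

theorem entryHom_injective (b : OrthonormalBasis κ ℂ K) (M : VonNeumannAlgebra H) :
    Function.Injective (entryHom b M) := fun _ _ h =>
  VNUnitary.toOp_injective <| eq_of_entry_eq b fun i j =>
    (congrArg Subtype.val (congrFun (congrFun h i) j) :)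

end CommVN

/-! ### Diagonal unitaries and the spikes -/

section Diagonal

variable {L ι : Type*} [NormedAddCommGroup L] [InnerProductSpace ℂ L] [Fintype ι]

/-- The operator which is diagonal in the orthonormal basis `b`, with diagonal entries `z`. -/
def diagOp (b : OrthonormalBasis ι ℂ L) (z : ι → ℂ) : L →L[ℂ] L :=
  ∑ i, z i • InnerProductSpace.rankOne ℂ (b i) (b i)

theorem repr_diagOp (b : OrthonormalBasis ι ℂ L) (z : ι → ℂ) (v : L) (i : ι) :
    b.repr (diagOp b z v) i = z i * b.repr v i := by
  classical
  simp [diagOp, b.repr_apply_apply, Pi.single_apply]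

/-- The unitary operators which are diagonal in a given orthonormal basis. -/
def diagUnitary (b : OrthonormalBasis ι ℂ L) : (ι → Circle) →* (L ≃ₗᵢ[ℂ] L) where
  toFun z :=
    { toLinearEquiv := LinearEquiv.ofLinearMap (diagOp b fun i => z i) (diagOp b fun i => (z i)⁻¹)
        (by
          ext v
          refine b.repr.injective (PiLp.ext fun i => ?_)
          simp [repr_diagOp])
        (by
          ext v
          refine b.repr.injective (PiLp.ext fun i => ?_)
          simp [repr_diagOp])
      norm_map' v := by
        rw [← b.repr.norm_map, ← b.repr.norm_map v, EuclideanSpace.norm_eq, EuclideanSpace.norm_eq]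
        simp [repr_diagOp, Circle.norm_coe] }
  map_one' := by
    ext v
    refine b.repr.injective (PiLp.ext fun i => ?_)
    exact (repr_diagOp b _ v i).trans (by simp)
  map_mul' z w := by
    ext v
    refine b.repr.injective (PiLp.ext fun i => ?_)
    refine (repr_diagOp b _ v i).trans ?_
    refine Eq.trans ?_ (repr_diagOp b _ _ i).symm
    refine Eq.trans ?_ (congrArg _ (repr_diagOp b _ _ i).symm)
    simp [mul_assoc]

theorem coe_diagUnitary (b : OrthonormalBasis ι ℂ L) (z : ι → Circle) :
    ((diagUnitary b z).toContinuousLinearEquiv : L →L[ℂ] L) = diagOp b fun i => z i := rfl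

theorem diagUnitary_apply_basis (b : OrthonormalBasis ι ℂ L) (z : ι → Circle) (i : ι) :
    diagUnitary b z (b i) = (z i : ℂ) • b i := by
  classical
  refine b.repr.injective (PiLp.ext fun j => ?_)
  refine (repr_diagOp b _ _ j).trans ?_
  rw [map_smul, PiLp.smul_apply, b.repr_self, PiLp.single_apply, smul_eq_mul]
  split_ifs with h <;> simp [h]

theorem eq_diagUnitary (b : OrthonormalBasis ι ℂ L) (z : ι → Circle) {U : L ≃ₗᵢ[ℂ] L}
    (h : ∀ i, U (b i) = (z i : ℂ) • b i) : U = diagUnitary b z := by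
  have : (U.toLinearEquiv : L →ₗ[ℂ] L) = ((diagUnitary b z).toLinearEquiv : L →ₗ[ℂ] L) :=
    b.toBasis.ext fun i => by
      rw [b.coe_toBasis]
      exact (h i).trans (diagUnitary_apply_basis b z i).symm
  exact LinearIsometryEquiv.ext fun v => LinearMap.congr_fun this v

theorem det_diagUnitary (b : OrthonormalBasis ι ℂ L) (z : ι → Circle) :
    LinearMap.det ((diagUnitary b z).toLinearEquiv : L →ₗ[ℂ] L) = ∏ i, (z i : ℂ) := by
  classical
  rw [← LinearMap.det_toMatrix b.toBasis, ← Matrix.det_diagonal]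
  congr 1
  ext i j
  rw [LinearMap.toMatrix_apply, b.coe_toBasis]
  change b.toBasis.repr (diagUnitary b z (b j)) i = _
  rw [diagUnitary_apply_basis, map_smul, ← b.coe_toBasis, Module.Basis.repr_self,
    Matrix.diagonal_apply]
  simp only [Finsupp.smul_apply, Finsupp.single_apply, smul_eq_mul]
  split_ifs <;> simp_all

variable [DecidableEq ι]

/-- The diagonal entries `w⁻¹, …, w⁻¹` multiplied by `w ^ n` at the place `j`, where `n` is the
number of entries. -/
def spike (w : Circle) (j : ι) : ι → Circle :=
  Pi.mulSingle j (w ^ Fintype.card ι) * fun _ => w⁻¹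

/-- At each place the single factor `w ^ n` cancels the `n` factors `w⁻¹`. -/
theorem prod_spike (w : Circle) : ∏ j : ι, spike w j = 1 := by
  simp only [spike, Finset.prod_mul_distrib, Finset.prod_const, Finset.card_univ]
  ext i : 1
  simp [Finset.prod_apply, Pi.mulSingle_apply]

theorem spike_pow {w : Circle} {p : ℕ} (hw : w ^ p = 1) (j : ι) : spike w j ^ p = 1 := by
  ext i : 1
  simp only [spike, Pi.pow_apply, Pi.mul_apply, Pi.one_apply, Pi.mulSingle_apply]
  split_ifs <;> simp [mul_pow, hw, pow_right_comm w _ p]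

theorem spike_perm (w : Circle) (σ : Equiv.Perm ι) (j i : ι) :
    spike w (σ j) (σ i) = spike w j i := by
  simp [spike, Pi.mulSingle_apply]

theorem equiv_mul_diagUnitary_spike (b : OrthonormalBasis ι ℂ L) (w : Circle) (σ : Equiv.Perm ι)
    (k : ι) : b.equiv b σ * diagUnitary b (spike w k) =
      diagUnitary b (spike w (σ k)) * b.equiv b σ := by
  refine LinearIsometryEquiv.toLinearEquiv_injective (b.toBasis.ext' fun i => ?_)
  rw [b.coe_toBasis]
  change b.equiv b σ (diagUnitary b (spike w k) (b i)) =
    diagUnitary b (spike w (σ k)) (b.equiv b σ (b i))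
  rw [diagUnitary_apply_basis, map_smul, b.equiv_apply_basis, diagUnitary_apply_basis, spike_perm]

theorem Circle.exists_pow_eq (z : Circle) {n : ℕ} (hn : n ≠ 0) : ∃ w : Circle, w ^ n = z := by
  refine ⟨Circle.exp (Complex.arg z / n), ?_⟩
  rw [← Circle.exp_nsmul, nsmul_eq_mul, mul_div_cancel₀ _ (by exact_mod_cast hn), Circle.exp_arg]

/-- If `w j ^ n = z j` and `∏ w j = 1`, the product of the spikes has `i`-th entry `w i ^ n * ∏ (w
j)⁻¹ = z i`. -/
theorem exists_eq_prod_spike [Nonempty ι] {z : ι → Circle} (hz : ∏ i, z i = 1) :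
    ∃ w : ι → Circle, z = ∏ j, spike (w j) j := by
  choose w hw using fun i => Circle.exists_pow_eq (z i) (Fintype.card_ne_zero (α := ι))
  have h1 : (∏ i, w i) ^ Fintype.card ι = 1 := by
    rw [← Finset.prod_pow, ← hz]
    exact Finset.prod_congr rfl fun i _ => hw i
  let i₀ := Classical.arbitrary ι
  -- The product of the chosen roots is an `n`-th root of unity, so dividing one of them by it makes
  -- the product `1` without changing any `n`-th power.
  let w' : ι → Circle := w * Pi.mulSingle i₀ (∏ i, w i)⁻¹
  refine ⟨w', ?_⟩
  have h2 : ∏ j, w' j = 1 := by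
    simp [w', Finset.prod_mul_distrib]
  have h3 : ∀ j, w' j ^ Fintype.card ι = z j := by
    intro j
    simp only [w']
    rw [Pi.mul_apply, mul_pow, hw, Pi.mulSingle_apply]
    split_ifs <;> simp [h1]
  ext i : 1
  simp only [Finset.prod_apply, spike, Pi.mul_apply (Pi.mulSingle _ _), Finset.prod_mul_distrib,
    Finset.prod_inv_distrib, h2, h3]
  simp [Pi.mulSingle_apply]

theorem dense_torsion_coprime {n : ℕ} (hn : n ≠ 0) :
    Dense {w : Circle | ∃ p : ℕ, p ≠ 0 ∧ p.Coprime n ∧ w ^ p = 1} := by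
  intro w
  -- The natural-number floor used next needs `0 ≤ θ`, hence the shift of the argument by `2π`. The
  -- denominators `n * N + 1` are coprime to `n`.
  obtain ⟨θ, hθ, rfl⟩ : ∃ θ : ℝ, 0 ≤ θ ∧ Circle.exp (2 * Real.pi * θ) = w := by
    refine ⟨(Complex.arg w + 2 * Real.pi) / (2 * Real.pi), ?_, ?_⟩
    · have := Complex.neg_pi_lt_arg w
      have := Real.pi_pos
      apply div_nonneg <;> linarith
    · rw [mul_div_cancel₀ _ (by positivity), Circle.exp_add_two_pi, Circle.exp_arg]
  refine mem_closure_of_tendsto (f := fun N : ℕ => Circle.exp (2 * Real.pi *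
    (⌊θ * ((n * N + 1 : ℕ) : ℝ)⌋₊ / ((n * N + 1 : ℕ) : ℝ)))) (b := Filter.atTop) ?_ ?_
  · have h := (tendsto_nat_floor_mul_div_atTop (R := ℝ) hθ).comp
      (tendsto_natCast_atTop_atTop.comp (Filter.tendsto_atTop_mono (g := fun N => n * N + 1) ?_
        Filter.tendsto_id))
    · exact (Circle.exp.continuous.tendsto _).comp (h.const_mul _)
    · exact fun N => Nat.le_succ_of_le (Nat.le_mul_of_pos_left N (Nat.pos_of_ne_zero hn))
  · refine Filter.Eventually.of_forall fun N => ⟨n * N + 1, by simp, ?_, ?_⟩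
    · simp
    · rw [← Circle.exp_nsmul, nsmul_eq_mul, mul_left_comm, mul_div_cancel₀ _ (by positivity),
        mul_comm, ← nsmul_eq_mul, Circle.exp_nsmul, Circle.exp_two_pi, one_pow]

end Diagonal

/-! ### Diagonalization of unitaries in finite dimension -/

section Spectral

open Module.End

variable {L : Type*} [NormedAddCommGroup L] [InnerProductSpace ℂ L] [FiniteDimensional ℂ L]

/-- `U + U*` and `i(U - U*)` are commuting symmetric operators, so their joint eigenspaces decompose
the space orthogonally; an adapted orthonormal basis diagonalizes `U`. -/
theorem exists_eq_diagUnitary (U : L ≃ₗᵢ[ℂ] L) :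
    ∃ (b : OrthonormalBasis (Fin (Module.finrank ℂ L)) ℂ L)
      (z : Fin (Module.finrank ℂ L) → Circle), U = diagUnitary b z := by
  classical
  let X : L →ₗ[ℂ] L := U.toLinearEquiv
  let Y : L →ₗ[ℂ] L := U.symm.toLinearEquiv
  have hX : ∀ x y : L, inner ℂ (X x) y = inner ℂ x (Y y) := fun x y => by
    rw [← U.inner_map_map x (Y y)]
    exact congrArg _ (U.apply_symm_apply y).symm
  have hY : ∀ x y : L, inner ℂ (Y x) y = inner ℂ x (X y) := fun x y => by
    rw [← U.inner_map_map (Y x) y]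
    exact congrArg (fun t => inner ℂ t (X y)) (U.apply_symm_apply x)
  have hXY : Commute X Y := by
    ext v
    exact (U.apply_symm_apply v).trans (U.symm_apply_apply v).symm
  have hA : (X + Y).IsSymmetric := fun x y => by
    simp only [LinearMap.add_apply, inner_add_left, inner_add_right, hX, hY, add_comm]
  have hB : (Complex.I • (X - Y)).IsSymmetric := fun x y => by
    simp only [LinearMap.smul_apply, LinearMap.sub_apply, inner_smul_left, inner_smul_right,
      inner_sub_left, inner_sub_right, hX, hY, Complex.conj_I]
    ring
  have hAB : Commute (X + Y) (Complex.I • (X - Y)) :=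
    ((((Commute.refl X).sub_right hXY).add_left (hXY.symm.sub_right (Commute.refl Y)))).smul_right _
  have hort := LinearMap.IsSymmetric.orthogonalFamily_eigenspace_inf_eigenspace hA hB
  have hint := LinearMap.IsSymmetric.directSum_isInternal_of_commute hA hB hAB
  have := hint.submodule_iSupIndep.fintypeNeBotOfFiniteDimensional
  have hint' := DirectSum.isInternal_ne_bot_iff.2 hint
  have hort' := hort.comp (Subtype.val_injective (p := fun i : ℂ × ℂ =>
    eigenspace (X + Y) i.2 ⊓ eigenspace (Complex.I • (X - Y)) i.1 ≠ ⊥))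
  let b := hint'.subordinateOrthonormalBasis rfl hort'
  have hb : ∀ i, ∃ c : ℂ, U (b i) = c • b i := by
    intro i
    have hmem := hint'.subordinateOrthonormalBasis_subordinate rfl i hort'
    set s : ℂ × ℂ := Subtype.val (hint'.subordinateOrthonormalBasisIndex rfl i hort')
    obtain ⟨h1, h2⟩ := Submodule.mem_inf.1 hmem
    rw [mem_eigenspace_iff] at h1 h2
    change X (b i) + Y (b i) = s.2 • b i at h1
    change Complex.I • (X (b i) - Y (b i)) = s.1 • b i at h2
    refine ⟨(s.2 - Complex.I * s.1) / 2, ?_⟩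
    change X (b i) = _
    have h3 : X (b i) - Y (b i) = (-(Complex.I * s.1)) • b i := by
      rw [neg_smul, mul_smul, ← h2, smul_smul, Complex.I_mul_I, neg_one_smul, neg_neg]
    have h4 : (2 : ℂ) • X (b i) = (s.2 - Complex.I * s.1) • b i := by
      rw [sub_eq_add_neg, add_smul, ← h1, ← h3, two_smul]
      abel
    rw [div_eq_inv_mul, mul_smul, ← h4, smul_smul, inv_mul_cancel₀ two_ne_zero, one_smul]
  choose c hc using hb
  have hnorm : ∀ i, ‖c i‖ = 1 := fun i => by
    have := congrArg norm (hc i)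
    rw [U.norm_map, norm_smul, b.orthonormal.1, mul_one] at this
    exact this.symm
  exact ⟨b, fun i => ⟨c i, mem_sphere_zero_iff_norm.2 (hnorm i)⟩, eq_diagUnitary b _ hc⟩

end Spectral

/-! ### Strong continuity of the embedding on diagonal unitaries -/

section Continuity

variable {H K : Type*} [NormedAddCommGroup H] [InnerProductSpace ℂ H] [CompleteSpace H]
  [NormedAddCommGroup K] [InnerProductSpace ℂ K] [CompleteSpace K]

/-- The linear map `y ↦ 1 ⊗ y`. -/
def oneTensor (H K : Type*) [NormedAddCommGroup H] [InnerProductSpace ℂ H] [NormedAddCommGroup K]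
    [InnerProductSpace ℂ K] :
    (K →L[ℂ] K) →ₗ[ℂ] (HilbertTensor H K →L[ℂ] HilbertTensor H K) where
  toFun y := tensorOp 1 y
  map_add' x y := ext_coe fun v => by
    rw [add_apply, tensorOp_coe, tensorOp_coe, tensorOp_coe,
      ← UniformSpace.Completion.coe_add]
    congr 1
    induction v with
    | zero => simp
    | add a b ha hb => simp only [map_add, ha, hb]; abel
    | tmul h k => simp [TensorProduct.tmul_add]
  map_smul' c y := ext_coe fun v => by
    rw [smul_apply, tensorOp_coe, tensorOp_coe, ← UniformSpace.Completion.coe_smul]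
    congr 1
    induction v with
    | zero => simp
    | add a b ha hb => simp only [map_add, ha, hb, smul_add]
    | tmul h k => simp [TensorProduct.tmul_smul]

instance (M : VonNeumannAlgebra H) : T2Space (VNUnitary M) :=
  T2Space.of_injective_continuous (f := fun U : VNUnitary M => (fun v => U.toOp v : H → H))
    (fun _ _ h => VNUnitary.toOp_injective (DFunLike.coe_injective h))
    continuous_induced_dom

variable (L : Submodule ℂ K) [FiniteDimensional ℂ L]

/-- The homomorphism `U ↦ (0, 1 ⊗ (U ⊕ 1))`. -/
def embedHom (d : ℕ) (M : VonNeumannAlgebra H) :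
    (L ≃ₗᵢ[ℂ] L) →* ProdGroup d (tensorB M K) where
  toFun U := (Multiplicative.ofAdd 0, embed M L U)
  map_one' := Prod.ext rfl <| VNUnitary.toOp_injective <| by
    change tensorOp 1 (directSumOne L 1) = 1
    rw [directSumOne_one, tensorOp_one]
  map_mul' U V := Prod.ext (by simp) <| VNUnitary.toOp_injective <| by
    change tensorOp 1 (directSumOne L (U * V)) =
      tensorOp 1 (directSumOne L U) * tensorOp 1 (directSumOne L V)
    rw [← tensorOp_mul, directSumOne_mul, one_mul]

variable {ι : Type*} [Fintype ι]

theorem continuous_embedHom_diagUnitary (d : ℕ) (M : VonNeumannAlgebra H)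
    (b : OrthonormalBasis ι ℂ L) :
    Continuous fun z : ι → Circle => embedHom L d M (diagUnitary b z) := by
  refine continuous_const.prodMk (continuous_induced_rng.2 (continuous_pi fun v => ?_))
  -- Applied to a fixed vector, the operator is affine in the finitely many coordinates `z i`.
  have h : ∀ z : ι → Circle, (embed M L (diagUnitary b z)).toOp v =
      (∑ i, (z i : ℂ) • oneTensor H K (L.subtypeL ∘L InnerProductSpace.rankOne ℂ (b i) (b i) ∘L
        L.orthogonalProjectionOnto) v) + oneTensor H K Lᗮ.starProjection v := by
    intro z
    have h1 : directSumOne L (diagUnitary b z) =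
        ∑ i, (z i : ℂ) • (L.subtypeL ∘L InnerProductSpace.rankOne ℂ (b i) (b i) ∘L
          L.orthogonalProjectionOnto) + Lᗮ.starProjection := by
      rw [directSumOne, coe_diagUnitary, diagOp]
      congr 1
      ext x
      simp [sum_apply]
    change oneTensor H K (directSumOne L (diagUnitary b z)) v = _
    rw [h1, map_add, map_sum, add_apply, sum_apply]
    simp only [map_smul, smul_apply]
  simp only [Function.comp_def]
  exact (continuous_congr h).2 (by fun_prop)

end Continuity

/-! ### Vanishing on the special unitary group -/

section Main

variable {H₁ H₂ K₁ K₂ : Type*}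
  [NormedAddCommGroup H₁] [InnerProductSpace ℂ H₁] [CompleteSpace H₁]
  [NormedAddCommGroup H₂] [InnerProductSpace ℂ H₂] [CompleteSpace H₂]
  [NormedAddCommGroup K₁] [InnerProductSpace ℂ K₁] [CompleteSpace K₁] [FiniteDimensional ℂ K₁]
  [NormedAddCommGroup K₂] [InnerProductSpace ℂ K₂] [CompleteSpace K₂]
  {M₁ : VonNeumannAlgebra H₁} {M₂ : VonNeumannAlgebra H₂} {d : ℕ}

theorem isUnit_natCast (M : VonNeumannAlgebra H₁) {p : ℕ} (hp : p ≠ 0) : IsUnit (p : M) := by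
  have hp' : (p : ℂ) ≠ 0 := Nat.cast_ne_zero.2 hp
  have hmem : ((p : ℂ)⁻¹ • (1 : H₁ →L[ℂ] H₁)) ∈ M :=
    show _ ∈ M.toStarSubalgebra from SMulMemClass.smul_mem _ (one_mem _)
  refine ⟨⟨p, ⟨_, hmem⟩, ?_, ?_⟩, rfl⟩ <;> refine Subtype.ext ?_ <;> ext v <;>
    simp [hp', ← Nat.cast_smul_eq_nsmul ℂ, smul_smul]

theorem map_diagUnitary_spike_eq_one_of_pow_eq_one (hM₁ : ∀ a ∈ M₁, ∀ b ∈ M₁, a * b = b * a)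
    {L : Type*} [NormedAddCommGroup L] [InnerProductSpace ℂ L] {ι : Type*} [Fintype ι]
    [DecidableEq ι] (hcard : Module.finrank ℂ K₁ < Fintype.card ι)
    (Ψ : (L ≃ₗᵢ[ℂ] L) →* ProdGroup d (tensorB M₁ K₁)) (b : OrthonormalBasis ι ℂ L)
    {w : Circle} {p : ℕ} (hp : p ≠ 0) (hcop : p.Coprime (Fintype.card ι)) (hw : w ^ p = 1) (j : ι) :
    Ψ (diagUnitary b (spike w j)) = 1 := by
  refine Prod.ext ?_ ?_
  -- The component in `ℝ^d` is torsion, hence zero.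
  · have h : (Ψ (diagUnitary b (spike w j))).1 ^ p = 1 := by
      rw [← Prod.pow_fst, ← map_pow, ← map_pow, spike_pow hw, map_one, map_one, Prod.fst_one]
    have h' : p • Multiplicative.toAdd (Ψ (diagUnitary b (spike w j))).1 = 0 := h
    rw [← Nat.cast_smul_eq_nsmul ℝ] at h'
    exact (smul_eq_zero.1 h').resolve_left (Nat.cast_ne_zero.2 hp)
  · let _ : CommRing M₁ := { (inferInstance : Ring M₁) with
      mul_comm := fun a b => Subtype.ext (hM₁ a a.2 b b.2) }
    have _ : IsReduced M₁ := isReduced_of_commute M₁ hM₁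
    let b₁ := stdOrthonormalBasis ℂ K₁
    refine entryHom_injective b₁ M₁ ?_
    rw [Prod.snd_one, map_one]
    exact matrix_map_eq_one_of_card_lt (diagUnitary b) (t := spike w)
      ((entryHom b₁ M₁).comp ((MonoidHom.snd _ _).comp Ψ)) (isUnit_natCast M₁ hp) hcop
      (spike_pow hw) (prod_spike w)
      (fun i j => ⟨b.equiv b (Equiv.swap i j), equiv_mul_diagUnitary_spike b w _⟩)
      (by simpa using hcard) j

theorem map_embedHom_eq_one (hM₁ : ∀ a ∈ M₁, ∀ b ∈ M₁, a * b = b * a)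
    (Φ : ProdGroup d (tensorB M₂ K₂) →* ProdGroup d (tensorB M₁ K₁)) (hΦ : Continuous Φ)
    (L : Submodule ℂ K₂) [FiniteDimensional ℂ L]
    (hlt : Module.finrank ℂ K₁ < Module.finrank ℂ L) {U : L ≃ₗᵢ[ℂ] L} (hU : U ∈ specialUnitary L) :
    Φ (embedHom L d M₂ U) = 1 := by
  obtain ⟨b, z, rfl⟩ := exists_eq_diagUnitary U
  have hz : ∏ i, z i = 1 := by
    have h : LinearMap.det ((diagUnitary b z).toLinearEquiv : L →ₗ[ℂ] L) = 1 := hU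
    rw [det_diagUnitary] at h
    refine Circle.ext ?_
    rw [Circle.coe_one, ← h]
    exact map_prod Circle.coeHom z Finset.univ
  have hne : Nonempty (Fin (Module.finrank ℂ L)) := ⟨⟨0, by omega⟩⟩
  have key : ∀ j (w : Circle), Φ (embedHom L d M₂ (diagUnitary b (spike w j))) = 1 := by
    intro j w
    have hcont : Continuous fun w : Circle =>
        Φ (embedHom L d M₂ (diagUnitary b (spike w j))) := by
      refine hΦ.comp ((continuous_embedHom_diagUnitary L d M₂ b).comp ?_)
      refine continuous_pi fun i => ?_
      simp only [spike, Pi.mul_apply, Pi.mulSingle_apply]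
      split_ifs <;> fun_prop
    refine congrFun (hcont.ext_on (dense_torsion_coprime (Fintype.card_ne_zero
      (α := Fin (Module.finrank ℂ L)))) continuous_const ?_) w
    rintro w ⟨p, hp, hcop, hw⟩
    exact map_diagUnitary_spike_eq_one_of_pow_eq_one hM₁ (by simpa using hlt)
      (Φ.comp (embedHom L d M₂)) b hp hcop hw j
  obtain ⟨w, rfl⟩ := exists_eq_prod_spike hz
  exact prod_mem (S := ((Φ.comp (embedHom L d M₂)).comp (diagUnitary b)).ker)
    fun j _ => key j (w j)

end Main

/-! ### Dimension counts and non-injectivity -/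

section Dimension

variable {K : Type*} [NormedAddCommGroup K] [InnerProductSpace ℂ K]

theorem hilbertDim_eq_finrank [FiniteDimensional ℂ K] : hilbertDim K = Module.finrank ℂ K := by
  rw [hilbertDim, ← Module.finrank_eq_rank, Cardinal.toENat_nat]

theorem finiteDimensional_of_hilbertDim_lt {a : ℕ∞} (h : hilbertDim K < a) :
    FiniteDimensional ℂ K := by
  rw [FiniteDimensional, ← Module.rank_lt_aleph0_iff, ← Cardinal.toENat_lt_top]
  exact h.trans_le le_top

theorem exists_submodule_finrank_eq {n : ℕ} (h : (n : ℕ∞) ≤ hilbertDim K) :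
    ∃ L : Submodule ℂ K, FiniteDimensional ℂ L ∧ Module.finrank ℂ L = n := by
  obtain ⟨s, hs, hli⟩ := exists_finset_linearIndependent_of_le_rank
    (Cardinal.natCast_le_toENat.1 h)
  exact ⟨Submodule.span ℂ s, inferInstance, (finrank_span_finset_eq_card hli).trans hs⟩

end Dimension

theorem exists_specialUnitary_ne_one {L : Type*} [NormedAddCommGroup L] [InnerProductSpace ℂ L]
    [FiniteDimensional ℂ L] (h : 1 < Module.finrank ℂ L) :
    ∃ U ∈ specialUnitary L, U ≠ 1 := by
  let b := stdOrthonormalBasis ℂ L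
  let i : Fin (Module.finrank ℂ L) := ⟨0, by omega⟩
  let j : Fin (Module.finrank ℂ L) := ⟨1, h⟩
  have hij : i ≠ j := by simp [i, j]
  -- Since `exp(iπ) = -1` is its own inverse, this is `-1` at `i` and `j` and `1` elsewhere, of
  -- determinant one.
  let z : Fin (Module.finrank ℂ L) → Circle :=
    Pi.mulSingle i (Circle.exp Real.pi) * Pi.mulSingle j (Circle.exp Real.pi)⁻¹
  refine ⟨diagUnitary b z, ?_, fun hU => ?_⟩
  · change LinearMap.det ((diagUnitary b z).toLinearEquiv : L →ₗ[ℂ] L) = 1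
    have h1 : ∏ k, z k = 1 := by simp [z, Finset.prod_mul_distrib]
    rw [det_diagUnitary, ← Circle.coe_one, ← h1]
    exact (map_prod Circle.coeHom z Finset.univ).symm
  · have h1 := diagUnitary_apply_basis b z i
    rw [hU] at h1
    have h2 : (z i : ℂ) = -1 := by
      simp [z, hij]
    have h3 : b i = -b i := by rwa [h2, neg_one_smul] at h1
    have h4 : (2 : ℂ) • b i = 0 := by
      rw [two_smul]
      exact eq_neg_iff_add_eq_zero.1 h3
    exact b.orthonormal.ne_zero i ((smul_eq_zero.1 h4).resolve_left two_ne_zero)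

/-- Applying `1 ⊗ (U ⊕ 1)` to `x ⊗ v` with `x ≠ 0` and `v ∈ L` recovers `U v`, because the tensor
norm is multiplicative on pure tensors. -/
theorem embed_injective {H K : Type*} [NormedAddCommGroup H] [InnerProductSpace ℂ H]
    [CompleteSpace H] [Nontrivial H] [NormedAddCommGroup K] [InnerProductSpace ℂ K]
    [CompleteSpace K] (M : VonNeumannAlgebra H) (L : Submodule ℂ K) [FiniteDimensional ℂ L] :
    Function.Injective (embed M L) := by
  intro U V h
  obtain ⟨x, hx⟩ := exists_ne (0 : H)
  ext v
  have h1 : tensorOp (1 : H →L[ℂ] H) (directSumOne L U) = tensorOp 1 (directSumOne L V) :=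
    congrArg VNUnitary.toOp h
  have h2 := congrArg (fun T => T ((x ⊗ₜ[ℂ] (v : K) : H ⊗[ℂ] K) : HilbertTensor H K)) h1
  simp only [tensorOp_coe_tmul, one_apply_eq_self] at h2
  have h3 := UniformSpace.Completion.coe_injective _ h2
  have h4 : ∀ W : L ≃ₗᵢ[ℂ] L, directSumOne L W v = W v := fun W => by
    simpa using directSumOne_add L W v (zero_mem Lᗮ)
  rw [h4, h4, ← sub_eq_zero, ← TensorProduct.tmul_sub, ← norm_eq_zero, TensorProduct.norm_tmul,
    mul_eq_zero, norm_eq_zero, norm_eq_zero, sub_eq_zero] at h3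
  exact h3.resolve_left hx

end VNTensor

end

theorem mainTheorem8 (d : ℕ) {H₁ H₂ K₁ K₂ : Type*}
    [NormedAddCommGroup H₁] [InnerProductSpace ℂ H₁] [CompleteSpace H₁]
    [TopologicalSpace.SeparableSpace H₁] [Nontrivial H₁]
    [NormedAddCommGroup H₂] [InnerProductSpace ℂ H₂] [CompleteSpace H₂]
    [TopologicalSpace.SeparableSpace H₂] [Nontrivial H₂]
    [NormedAddCommGroup K₁] [InnerProductSpace ℂ K₁] [CompleteSpace K₁]
    [TopologicalSpace.SeparableSpace K₁] [Nontrivial K₁]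
    [NormedAddCommGroup K₂] [InnerProductSpace ℂ K₂] [CompleteSpace K₂]
    [TopologicalSpace.SeparableSpace K₂] [Nontrivial K₂]
    (M₁ : VonNeumannAlgebra H₁) (M₂ : VonNeumannAlgebra H₂)
    (hM₁ : ∀ a ∈ M₁, ∀ b ∈ M₁, a * b = b * a)
    (hM₂ : ∀ a ∈ M₂, ∀ b ∈ M₂, a * b = b * a)
    (hK : VNTensor.hilbertDim K₁ < VNTensor.hilbertDim K₂)
    (Φ : VNTensor.ProdGroup d (VNTensor.tensorB M₂ K₂) →*
      VNTensor.ProdGroup d (VNTensor.tensorB M₁ K₁))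
    (hΦ : Continuous Φ) :
    (∀ (L : Submodule ℂ K₂) [FiniteDimensional ℂ L],
      VNTensor.hilbertDim K₁ < VNTensor.hilbertDim L →
      ∀ U ∈ VNTensor.specialUnitary L,
        (Multiplicative.ofAdd 0, VNTensor.embed M₂ L U) ∈ Φ.ker) ∧
    ¬ Function.Injective Φ := by
  have := VNTensor.finiteDimensional_of_hilbertDim_lt hK
  have main : ∀ (L : Submodule ℂ K₂) [FiniteDimensional ℂ L],
      VNTensor.hilbertDim K₁ < VNTensor.hilbertDim L →
      ∀ U ∈ VNTensor.specialUnitary L,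
        (Multiplicative.ofAdd 0, VNTensor.embed M₂ L U) ∈ Φ.ker := by
    intro L _ hlt U hU
    rw [VNTensor.hilbertDim_eq_finrank, VNTensor.hilbertDim_eq_finrank, Nat.cast_lt] at hlt
    exact VNTensor.map_embedHom_eq_one hM₁ Φ hΦ L hlt hU
  refine ⟨main, fun hinj => ?_⟩
  rw [VNTensor.hilbertDim_eq_finrank] at hK
  -- `K₁` is non-zero, so this dimension is at least `2` and `SU(L)` is nontrivial.
  obtain ⟨L, hL, hr⟩ := VNTensor.exists_submodule_finrank_eq
    (n := Module.finrank ℂ K₁ + 1) (by exact_mod_cast Order.add_one_le_of_lt hK)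
  have hpos : 0 < Module.finrank ℂ K₁ := Module.finrank_pos
  obtain ⟨U, hU, hne⟩ := VNTensor.exists_specialUnitary_ne_one (L := L) (by omega)
  have hker : Φ (VNTensor.embedHom L d M₂ U) = 1 := main L (by
    rw [VNTensor.hilbertDim_eq_finrank, VNTensor.hilbertDim_eq_finrank, hr, Nat.cast_lt]
    exact Nat.lt_succ_self _) U hU
  have h1 : VNTensor.embedHom L d M₂ U = VNTensor.embedHom L d M₂ 1 :=
    hinj (by rw [hker, map_one, map_one])
  exact hne (VNTensor.embed_injective M₂ L (congrArg Prod.snd h1))
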